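/- Let $0<\epsilon\le 1$. There is a constant $C=C_\epsilon>0$, depending only on $\epsilon$, such that the following holds. Let $\Delta=\Delta(m)$ be a real-valued function on the positive integers with $\Delta(m)\to\infty$ as $m\to\infty$. For every integer $m\ge 2$ with $\Delta(m)>0$, every real $N$ with $m^{1/(2-\epsilon)}\le N\le m$ and every real $S$, the set of residue classes $$\Big\{xy \pmod m:\ x,y\in\mathbb{Z},\ \tfrac N4\le x\le N,\ S+1\le y\le S+\Delta(m)\, m^{1/2}\sqrt{\tfrac{m}{\phi(m)}}\,\log m,\ \gcd(x,y)=1\Big\}$$ contains $$\Big(1+O_\epsilon\big(\Delta(m)^{-1}\big)+O_\epsilon\Big(\frac{\Delta(m)}{\log m}\sqrt{\frac{m}{\phi(m)}}\Big)\Big)m$$ residue classes modulo $m$; that is, its cardinality differs from $m$ by at most $$C\Big(\frac1{\Delta(m)}+\frac{\Delta(m)}{\log m}\sqrt{\frac{m}{\phi(m)}}\Big)m .$$ Here $\phi$ is Euler's function. -/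

import Mathlib

open Filter

/-- The length `Δ m^{1/2} √(m / φ(m)) log m` of the interval in which `y` varies,
where `D` is the value of `Δ` at `m`. -/
noncomputable def yLength (m : ℕ) (D : ℝ) : ℝ :=
  D * Real.sqrt (m : ℝ) * Real.sqrt ((m : ℝ) / (Nat.totient m : ℝ)) * Real.log (m : ℝ)

/-- The residue classes `xy (mod m)` with integers `N / 4 ≤ x ≤ N`,
`S + 1 ≤ y ≤ S + Y` and `gcd(x, y) = 1`. -/
def coprimeProductClasses (m : ℕ) (N S Y : ℝ) : Set (ZMod m) :=
  {c | ∃ x y : ℤ, N / 4 ≤ (x : ℝ) ∧ (x : ℝ) ≤ N ∧ S + 1 ≤ (y : ℝ) ∧ (y : ℝ) ≤ S + Y ∧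
    Int.gcd x y = 1 ∧ ((x * y : ℤ) : ZMod m) = c}

/-! Restrict `x` to a set `X` of about `N / log m` primes in `[N/4, N]` not dividing `m`, and write
`y = s + i + j` with `i, j < L`, `L ≈ Y/2`. Let `f c` count the representations of a class `c`.
Cauchy–Schwarz on the support of `f` and Parseval bound the number of missed classes by `m` times
the sum of the squared nonzero Fourier coefficients, over `(∑ f)²`.

Since `i` and `j` vary independently, the coefficient at `h` is at most `L² ∑_x w(hx)`, where `w(u)
= min(1, H²/|u|²)` and `H = m/(2L)`. In the second moment over `h`, put `u = hx`, `v = hy`. Then `uy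
≡ vx (mod m)`, so the sum is at most `∑ w(u) w(v)` times the number of solutions of this congruence
in a box (`sum_sq_sum_fejerWeight_le`). That number has main term `n² gcd(u,v,m)/m`
(`crossCount_le`), and averaging the gcd costs a factor `m/φ(m)` (`sum_fejerWeight_mul_gcd_le`). The
factors `√(m/φ(m))` and `log m` in the length of the `y`-interval compensate for this and for the
density of the primes, leaving `O(m/Δ)` missed classes.

Coprimality fails only if the prime `x` divides `y`; such pairs are few, and they give the second
error term (`le_ncard_coprimeProductClasses`). -/

/-! ### Fourier analysis on `ZMod m`. -/

/-- Parseval's identity on `ZMod m`. -/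
theorem sum_norm_sq_fourier {m : ℕ} [NeZero m] (f : ZMod m → ℂ) :
    ∑ h : ZMod m, ‖∑ c, f c * ZMod.stdAddChar (h * c)‖ ^ 2 = m * ∑ c, ‖f c‖ ^ 2 := by
  have key : ∀ h : ZMod m, ((‖∑ c, f c * ZMod.stdAddChar (h * c)‖ ^ 2 : ℝ) : ℂ) =
      ∑ c, ∑ d, f c * (starRingEnd ℂ) (f d) * ZMod.stdAddChar (h * (c - d)) := by
    intro h
    rw [Complex.ofReal_pow, ← Complex.mul_conj', map_sum, Finset.sum_mul_sum]
    refine Finset.sum_congr rfl fun c _ => Finset.sum_congr rfl fun d _ => ?_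
    rw [map_mul (starRingEnd ℂ), ← AddChar.map_neg_eq_conj, mul_sub, sub_eq_add_neg (h * c) (h * d),
      AddChar.map_add_eq_mul]
    ring
  apply Complex.ofReal_injective
  rw [Complex.ofReal_sum]
  simp_rw [key]
  have swap : ∑ h : ZMod m, ∑ c, ∑ d, f c * (starRingEnd ℂ) (f d) * ZMod.stdAddChar (h * (c - d)) =
      ∑ c, ∑ d, f c * (starRingEnd ℂ) (f d) * ∑ h : ZMod m, ZMod.stdAddChar (h * (c - d)) := by
    rw [Finset.sum_comm]
    refine Finset.sum_congr rfl fun c _ => ?_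
    rw [Finset.sum_comm]
    exact Finset.sum_congr rfl fun d _ => (Finset.mul_sum _ _ _).symm
  rw [swap]
  simp_rw [AddChar.sum_mulShift _ (ZMod.isPrimitive_stdAddChar m)]
  push_cast
  rw [Finset.mul_sum]
  refine Finset.sum_congr rfl fun c _ => ?_
  rw [Finset.sum_eq_single c]
  · simp [Complex.mul_conj']; ring
  · intro d _ hd
    simp [sub_eq_zero, hd.symm]
  · simp

/-- The number of zeros of a real function on `ZMod m` is controlled by its nonzero
Fourier coefficients. -/
theorem card_zeros_mul_sq_sum_le {m : ℕ} [NeZero m] (f : ZMod m → ℝ) :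
    ((Finset.univ.filter fun c => f c = 0).card : ℝ) * (∑ c, f c) ^ 2 ≤
      m * ∑ h ∈ Finset.univ.erase (0 : ZMod m),
        ‖∑ c, (f c : ℂ) * ZMod.stdAddChar (h * c)‖ ^ 2 := by
  have hP := sum_norm_sq_fourier (fun c => (f c : ℂ))
  rw [← Finset.add_sum_erase _ _ (Finset.mem_univ (0 : ZMod m))] at hP
  set V := ∑ h ∈ Finset.univ.erase (0 : ZMod m),
        ‖∑ c, (f c : ℂ) * ZMod.stdAddChar (h * c)‖ ^ 2
  have hV : 0 ≤ V := Finset.sum_nonneg fun _ _ => by positivity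
  have h0 : ‖∑ c, (f c : ℂ) * ZMod.stdAddChar ((0 : ZMod m) * c)‖ ^ 2 = (∑ c, f c) ^ 2 := by
    simp only [zero_mul, AddChar.map_zero_eq_one, mul_one]
    rw [← Complex.ofReal_sum, Complex.norm_real, Real.norm_eq_abs, sq_abs]
  simp only [Complex.norm_real, Real.norm_eq_abs, sq_abs] at hP
  rw [h0] at hP
  set Z := Finset.univ.filter fun c => f c = 0
  set A := Finset.univ.filter fun c => ¬ f c = 0
  have hcard : (Z.card : ℝ) + A.card = m := by
    have := Finset.card_filter_add_card_filter_not (s := (Finset.univ : Finset (ZMod m)))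
      (fun c => f c = 0)
    rw [Finset.card_univ, ZMod.card] at this
    exact_mod_cast this
  have hsum : ∑ c, f c = ∑ c ∈ A, f c := by
    rw [Finset.sum_filter_ne_zero]
  have hCS : (∑ c, f c) ^ 2 ≤ A.card * ∑ c, f c ^ 2 := by
    rw [hsum]
    refine (sq_sum_le_card_mul_sum_sq).trans ?_
    gcongr
    exact Finset.subset_univ _
  have hm : (0 : ℝ) < m := by exact_mod_cast Nat.pos_of_ne_zero (NeZero.ne m)
  have hZ : (0 : ℝ) ≤ Z.card := by positivity
  have hA : (A.card : ℝ) ≤ m := by linarith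
  -- By Parseval the bracket equals `m ∑ f²`. Writing `m = Z.card + A.card` on the left then cancels
  -- `A.card * (∑ f)²`.
  have h1 : (m : ℝ) * (∑ c, f c) ^ 2 ≤ A.card * ((∑ c, f c) ^ 2 + V) := by
    rw [hP]; nlinarith
  nlinarith

/-- The geometric sum over an additive character of `ZMod m`. -/
theorem norm_sum_stdAddChar_mul_le {m : ℕ} [NeZero m] (L : ℕ) (u : ZMod m) :
    ‖∑ i ∈ Finset.range L, ZMod.stdAddChar ((i : ZMod m) * u)‖ * (2 * |(u.valMinAbs : ℝ)|) ≤ m := by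
  have hm : (0 : ℝ) < m := by exact_mod_cast Nat.pos_of_ne_zero (NeZero.ne m)
  set z : ℂ := ZMod.stdAddChar u with hz
  have hpow : ∀ i : ℕ, ZMod.stdAddChar ((i : ZMod m) * u) = z ^ i := fun i => by
    rw [← nsmul_eq_mul, AddChar.map_nsmul_eq_pow]
  simp_rw [hpow]
  have hz1 : ‖z‖ = 1 := by simp [hz]
  set a : ℤ := u.valMinAbs with ha
  rcases eq_or_ne a 0 with h0 | h0
  · simp [h0]
  have hexp : z = Complex.exp (Complex.I * ((2 * Real.pi * a / m : ℝ) : ℂ)) := by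
    rw [hz, ← ZMod.coe_valMinAbs u, ZMod.stdAddChar_coe, ← ha]
    congr 1
    push_cast
    ring
  -- The least absolute residue keeps the half-angle in `[-π/2, π/2]`, where `|sin t| ≥ 2|t|/π`;
  -- hence `‖z - 1‖ ≥ 4|a|/m`.
  have hle : |Real.pi * a / m| ≤ Real.pi / 2 := by
    have h1 := ZMod.valMinAbs_mem_Ioc u
    rw [← ha] at h1
    have h2 : |(a : ℝ)| * 2 ≤ m := by
      have : |a| * 2 ≤ m := by
        rcases abs_cases a with h | h <;> rw [h.1] <;> [exact h1.2; linarith [h1.1]]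
      exact_mod_cast this
    rw [abs_div, abs_mul, abs_of_pos Real.pi_pos, abs_of_pos hm, div_le_div_iff₀ hm two_pos]
    nlinarith [Real.pi_pos]
  have hsin := Real.mul_abs_le_abs_sin hle
  have hden : 4 * |(a : ℝ)| / m ≤ ‖z - 1‖ := by
    rw [hexp, Complex.norm_exp_I_mul_ofReal_sub_one, norm_mul, Real.norm_eq_abs,
      Real.norm_eq_abs, abs_two, show 2 * Real.pi * a / m / 2 = Real.pi * a / m by ring]
    refine le_trans (le_of_eq ?_) (mul_le_mul_of_nonneg_left hsin two_pos.le)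
    rw [abs_div, abs_mul, abs_of_pos Real.pi_pos, abs_of_pos hm]
    field_simp
    ring
  have hpos : 0 < 4 * |(a : ℝ)| / m := by
    have : (0 : ℝ) < |(a : ℝ)| := abs_pos.2 (by exact_mod_cast h0)
    positivity
  have hne : z ≠ 1 := by
    rintro h
    rw [h, sub_self, norm_zero] at hden
    linarith
  have hnum : ‖z ^ L - 1‖ ≤ 2 := by
    refine (norm_sub_le _ _).trans ?_
    rw [norm_pow, hz1, one_pow, norm_one]
    norm_num
  rw [geom_sum_eq hne, norm_div]
  calc ‖z ^ L - 1‖ / ‖z - 1‖ * (2 * |(a : ℝ)|) ≤ 2 / (4 * |(a : ℝ)| / m) * (2 * |(a : ℝ)|) := by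
        gcongr
    _ = m := by
        have : (0 : ℝ) < |(a : ℝ)| := abs_pos.2 (by exact_mod_cast h0)
        field_simp
        norm_num

/-- The weight `min (1, H² / k²)`. -/
noncomputable def fejerWeight (H : ℝ) (k : ℕ) : ℝ := min 1 (H ^ 2 / (k : ℝ) ^ 2)

theorem fejerWeight_nonneg (H : ℝ) (k : ℕ) : 0 ≤ fejerWeight H k :=
  le_min zero_le_one (by positivity)

theorem fejerWeight_le_one (H : ℝ) (k : ℕ) : fejerWeight H k ≤ 1 := min_le_left _ _

/-- The trivial bound `L` and the geometric bound `m/(2|a|)` cross at `|a| = m/(2L)`, which fixes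
the scale of the weight. -/
theorem norm_sq_sum_stdAddChar_mul_le {m : ℕ} [NeZero m] {L : ℕ} (hL : 0 < L) {u : ZMod m}
    (hu : u ≠ 0) :
    ‖∑ i ∈ Finset.range L, ZMod.stdAddChar ((i : ZMod m) * u)‖ ^ 2 ≤
      L ^ 2 * fejerWeight (m / (2 * L)) u.valMinAbs.natAbs := by
  have hL' : (0 : ℝ) < L := by exact_mod_cast hL
  have h1 : ‖∑ i ∈ Finset.range L, ZMod.stdAddChar ((i : ZMod m) * u)‖ ≤ L := by
    refine (norm_sum_le _ _).trans ?_
    simp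
  have h2 := norm_sum_stdAddChar_mul_le L u
  have ha : (0 : ℝ) < |(u.valMinAbs : ℝ)| := by
    refine abs_pos.2 ?_
    exact_mod_cast (ZMod.valMinAbs_eq_zero u).not.2 hu
  rw [fejerWeight, mul_min_of_nonneg _ _ (by positivity), Nat.cast_natAbs, Int.cast_abs]
  refine le_min (by rw [mul_one]; gcongr) ?_
  rw [← div_pow, ← mul_pow]
  gcongr
  rw [← le_div_iff₀ (by positivity)] at h2
  refine h2.trans (le_of_eq ?_)
  field_simp

/-- For a set `X` of integers coprime to `m`, almost all classes mod `m` are products of an element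
of `X` and an integer `s + i + j` with `i, j < L`. -/
theorem card_not_product_mul_sq_le {m : ℕ} [NeZero m] {L : ℕ} (hL : 0 < L) (s : ℤ)
    (X : Finset ℕ) (hX : ∀ x ∈ X, x.Coprime m) (Z : Finset (ZMod m))
    (hZ : ∀ c ∈ Z, ∀ x ∈ X, ∀ i < L, ∀ j < L, (x : ZMod m) * (s + i + j) ≠ c) :
    (Z.card : ℝ) * (X.card : ℝ) ^ 2 ≤ m * ∑ h ∈ Finset.univ.erase (0 : ZMod m),
      (∑ x ∈ X, fejerWeight (m / (2 * L)) (h * x).valMinAbs.natAbs) ^ 2 := by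
  have hL' : (0 : ℝ) < L := by exact_mod_cast hL
  -- Two independent copies of `range L` make each Fourier coefficient contain the square of a
  -- geometric sum, so that it decays quadratically.
  set T := X ×ˢ Finset.range L ×ˢ Finset.range L
  let v : ℕ × ℕ × ℕ → ZMod m := fun t => (t.1 : ZMod m) * (s + t.2.1 + t.2.2)
  let f : ZMod m → ℝ := fun c => ∑ t ∈ T, if v t = c then 1 else 0
  have hsum : ∑ c, f c = X.card * L ^ 2 := by
    simp only [f]
    rw [Finset.sum_comm]
    simp only [Finset.sum_ite_eq, Finset.mem_univ, if_true, Finset.sum_const, T,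
      Finset.card_product, Finset.card_range, nsmul_eq_mul]
    push_cast
    ring
  have hfour : ∀ h : ZMod m, ∑ c, (f c : ℂ) * ZMod.stdAddChar (h * c) =
      ∑ t ∈ T, ZMod.stdAddChar (h * v t) := by
    intro h
    simp only [f, Complex.ofReal_sum, Finset.sum_mul]
    rw [Finset.sum_comm]
    refine Finset.sum_congr rfl fun t _ => ?_
    rw [Finset.sum_eq_single (v t)] <;> simp +contextual [eq_comm]
  have hbound : ∀ h ∈ Finset.univ.erase (0 : ZMod m),
      ‖∑ c, (f c : ℂ) * ZMod.stdAddChar (h * c)‖ ^ 2 ≤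
      (L ^ 2 * ∑ x ∈ X, fejerWeight (m / (2 * L)) (h * x).valMinAbs.natAbs) ^ 2 := by
    intro h hh
    rw [hfour, Finset.mul_sum]
    gcongr
    simp only [T, Finset.sum_product]
    refine (norm_sum_le _ _).trans (Finset.sum_le_sum fun x hx => ?_)
    have hxu : h * x ≠ 0 := by
      intro h0
      have hu : IsUnit (x : ZMod m) := (ZMod.isUnit_iff_coprime x m).2 (hX x hx)
      exact Finset.ne_of_mem_erase hh (hu.mul_left_eq_zero.1 h0)
    refine le_trans (le_of_eq ?_) (norm_sq_sum_stdAddChar_mul_le hL hxu)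
    have : ∀ i j : ℕ, (ZMod.stdAddChar (h * v (x, i, j)) : ℂ) = ZMod.stdAddChar (h * (x : ZMod m) * (s : ZMod m)) *
        (ZMod.stdAddChar ((i : ZMod m) * (h * (x : ZMod m))) *
          ZMod.stdAddChar ((j : ZMod m) * (h * (x : ZMod m)))) := by
      intro i j
      rw [← AddChar.map_add_eq_mul, ← AddChar.map_add_eq_mul]
      congr 1
      simp only [v]
      ring
    simp_rw [this, ← Finset.mul_sum]
    rw [norm_mul, AddChar.norm_apply, one_mul, ← Finset.sum_mul, norm_mul, sq]
  have hmain := card_zeros_mul_sq_sum_le f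
  rw [hsum] at hmain
  have hZf : (Z.card : ℝ) ≤ (Finset.univ.filter fun c => f c = 0).card := by
    norm_cast
    refine Finset.card_le_card fun c hc => ?_
    simp only [Finset.mem_filter, Finset.mem_univ, true_and, f]
    refine Finset.sum_eq_zero fun t ht => if_neg ?_
    simp only [T, Finset.mem_product, Finset.mem_range] at ht
    exact hZ c hc _ ht.1 _ ht.2.1 _ ht.2.2
  have h3 := Finset.sum_le_sum hbound
  have h4 : (L : ℝ) ^ 4 * ((Z.card : ℝ) * (X.card : ℝ) ^ 2) ≤ (L : ℝ) ^ 4 *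
      (m * ∑ h ∈ Finset.univ.erase (0 : ZMod m),
      (∑ x ∈ X, fejerWeight (m / (2 * L)) (h * x).valMinAbs.natAbs) ^ 2) := by
    calc (L : ℝ) ^ 4 * ((Z.card : ℝ) * (X.card : ℝ) ^ 2) = (Z.card : ℝ) * (X.card * L ^ 2) ^ 2 := by ring
      _ ≤ ((Finset.univ.filter fun c => f c = 0).card : ℝ) * (X.card * L ^ 2) ^ 2 := by gcongr
      _ ≤ _ := hmain
      _ ≤ m * ∑ h ∈ Finset.univ.erase (0 : ZMod m),
        (L ^ 2 * ∑ x ∈ X, fejerWeight (m / (2 * L)) (h * x).valMinAbs.natAbs) ^ 2 := by gcongr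
      _ = _ := by
        simp_rw [mul_pow]
        rw [← Finset.mul_sum]
        ring
  exact le_of_mul_le_mul_left h4 (by positivity)

/-! ### Linear congruences in a box. -/

theorem Int.card_le_of_pairwise_dvd_sub {A : Finset ℤ} {u v : ℝ} {d : ℕ} (hd : 0 < d) (huv : u ≤ v)
    (hA : ∀ x ∈ A, u ≤ (x : ℝ) ∧ (x : ℝ) ≤ v) (hdvd : ∀ x ∈ A, ∀ y ∈ A, (d : ℤ) ∣ x - y) :
    (A.card : ℝ) ≤ (v - u) / d + 1 := by
  have hd' : (0 : ℝ) < d := by exact_mod_cast hd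
  rcases A.eq_empty_or_nonempty with rfl | hne
  · have : 0 ≤ (v - u) / d := div_nonneg (by linarith) hd'.le
    simp only [Finset.card_empty, Nat.cast_zero]
    linarith
  set x₀ := A.min' hne with hx₀
  have hx₀A : x₀ ∈ A := A.min'_mem hne
  have hinj : Set.InjOn (fun x : ℤ => (x - x₀) / d) A := by
    intro x hx y hy hxy
    obtain ⟨k, hk⟩ := hdvd x hx x₀ hx₀A
    obtain ⟨l, hl⟩ := hdvd y hy x₀ hx₀A
    have hdz : (d : ℤ) ≠ 0 := by exact_mod_cast hd.ne'
    simp only [hk, hl, Int.mul_ediv_cancel_left _ hdz] at hxy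
    rw [hxy] at hk
    linarith
  have hmaps : ∀ x ∈ A, (x - x₀) / (d : ℤ) ∈ Finset.Icc (0 : ℤ) ⌊(v - u) / d⌋ := by
    intro x hx
    obtain ⟨k, hk⟩ := hdvd x hx x₀ hx₀A
    have hdz : (d : ℤ) ≠ 0 := by exact_mod_cast hd.ne'
    have hle : x₀ ≤ x := A.min'_le x hx
    have hkR : (x : ℝ) - x₀ = d * k := by exact_mod_cast hk
    rw [hk, Int.mul_ediv_cancel_left _ hdz, Finset.mem_Icc, Int.le_floor]
    constructor
    · by_contra! hneg
      have : (d : ℤ) * k < 0 := mul_neg_of_pos_of_neg (by exact_mod_cast hd) hneg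
      linarith
    · rw [le_div_iff₀ hd']
      linarith [(hA x hx).2, (hA x₀ hx₀A).1]
  have hcard := Finset.card_le_card_of_injOn _ hmaps hinj
  rw [Int.card_Icc] at hcard
  have hfl : 0 ≤ ⌊(v - u) / (d : ℝ)⌋ := Int.floor_nonneg.2 (div_nonneg (by linarith) hd'.le)
  have : (A.card : ℤ) ≤ ⌊(v - u) / (d : ℝ)⌋ + 1 := by omega
  have h2 : (A.card : ℝ) ≤ (⌊(v - u) / (d : ℝ)⌋ : ℝ) + 1 := by exact_mod_cast this
  linarith [Int.floor_le ((v - u) / (d : ℝ))]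

/-- The number of `(x, y) ∈ [1, n]²` with `m ∣ a y - b x`. -/
def crossCount (m n : ℕ) (a b : ℤ) : ℕ :=
  ((Finset.Icc 1 n ×ˢ Finset.Icc 1 n).filter fun p : ℕ × ℕ => (m : ℤ) ∣ a * p.2 - b * p.1).card

theorem crossCount_comm (m n : ℕ) (a b : ℤ) : crossCount m n a b = crossCount m n b a := by
  refine Finset.card_bij (fun p _ => (p.2, p.1)) ?_ ?_ ?_
  · rintro ⟨x, y⟩ h
    simp only [Finset.mem_filter, Finset.mem_product] at h ⊢
    refine ⟨⟨h.1.2, h.1.1⟩, ?_⟩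
    rw [← dvd_neg, neg_sub]
    exact h.2
  · rintro ⟨x, y⟩ _ ⟨x', y'⟩ _ h
    simp only [Prod.mk.injEq] at h
    simp [h.1, h.2]
  · rintro ⟨x, y⟩ h
    refine ⟨(y, x), ?_, rfl⟩
    simp only [Finset.mem_filter, Finset.mem_product] at h ⊢
    refine ⟨⟨h.1.2, h.1.1⟩, ?_⟩
    rw [← dvd_neg, neg_sub]
    exact h.2

/-- The value `a y - b x` is a multiple of `m` of size at most `2n|a|`, which gives the first
factor. Once it is fixed, coprimality determines `x` modulo `a`, and `x` determines `y`, which gives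
the second. -/
theorem crossCount_le_of_isCoprime {m : ℕ} (hm : 0 < m) (n : ℕ) {a b : ℤ} (ha : a ≠ 0)
    (hab : |b| ≤ |a|) (hcop : IsCoprime a b) :
    (crossCount m n a b : ℝ) ≤ (4 * n * |(a : ℝ)| / m + 1) * (n / |(a : ℝ)| + 1) := by
  have haR : (0 : ℝ) < |(a : ℝ)| := abs_pos.2 (by exact_mod_cast ha)
  have habR : |(b : ℝ)| ≤ |(a : ℝ)| := by exact_mod_cast hab
  set S := (Finset.Icc 1 n ×ˢ Finset.Icc 1 n).filter
    fun p : ℕ × ℕ => (m : ℤ) ∣ a * p.2 - b * p.1 with hS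
  let t : ℕ × ℕ → ℤ := fun p => a * p.2 - b * p.1
  have himg : ((S.image t).card : ℝ) ≤ 4 * n * |(a : ℝ)| / m + 1 := by
    have h := Int.card_le_of_pairwise_dvd_sub (A := S.image t) (u := -(2 * n * |(a : ℝ)|))
      (v := 2 * n * |(a : ℝ)|) hm (by nlinarith [(Nat.cast_nonneg n : (0 : ℝ) ≤ n)]) ?_ ?_
    · refine h.trans (le_of_eq ?_)
      ring
    · intro x hx
      obtain ⟨p, hp, rfl⟩ := Finset.mem_image.1 hx
      simp only [hS, Finset.mem_filter, Finset.mem_product, Finset.mem_Icc] at hp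
      have h1 : (p.1 : ℝ) ≤ n := by exact_mod_cast hp.1.1.2
      have h2 : (p.2 : ℝ) ≤ n := by exact_mod_cast hp.1.2.2
      rw [← abs_le]
      simp only [t]
      push_cast
      calc |(a : ℝ) * p.2 - b * p.1| ≤ |(a : ℝ) * p.2| + |(b : ℝ) * p.1| := abs_sub _ _
        _ = |(a : ℝ)| * p.2 + |(b : ℝ)| * p.1 := by simp [abs_mul]
        _ ≤ |(a : ℝ)| * n + |(a : ℝ)| * n := by gcongr
        _ = _ := by ring
    · intro x hx y hy
      obtain ⟨p, hp, rfl⟩ := Finset.mem_image.1 hx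
      obtain ⟨q, hq, rfl⟩ := Finset.mem_image.1 hy
      exact dvd_sub (Finset.mem_filter.1 hp).2 (Finset.mem_filter.1 hq).2
  have hfib : ∀ c ∈ S.image t, ((S.filter fun p => t p = c).card : ℝ) ≤ n / |(a : ℝ)| + 1 := by
    intro c _
    set F := S.filter fun p => t p = c with hF
    have hmem : ∀ p ∈ F, (p.1 : ℤ) ≤ n ∧ a * p.2 - b * p.1 = c := by
      intro p hp
      simp only [hF, hS, Finset.mem_filter, Finset.mem_product, Finset.mem_Icc] at hp
      exact ⟨by exact_mod_cast hp.1.1.1.2, hp.2⟩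
    have hinj : Set.InjOn (fun p : ℕ × ℕ => (p.1 : ℤ)) F := by
      intro p hp q hq hpq
      have h1 := (hmem p hp).2
      have h2 := (hmem q hq).2
      simp only at hpq
      rw [hpq, ← h2] at h1
      have h3 : (p.2 : ℤ) = q.2 := mul_left_cancel₀ ha (by linarith)
      exact Prod.ext (by exact_mod_cast hpq) (by exact_mod_cast h3)
    rw [← Finset.card_image_of_injOn hinj]
    have h := Int.card_le_of_pairwise_dvd_sub (A := F.image fun p : ℕ × ℕ => (p.1 : ℤ))
      (u := 0) (v := n) (Int.natAbs_pos.2 ha) (by positivity) ?_ ?_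
    · simpa [Nat.cast_natAbs] using h
    · intro x hx
      obtain ⟨p, hp, rfl⟩ := Finset.mem_image.1 hx
      exact ⟨by positivity, by exact_mod_cast (hmem p hp).1⟩
    · intro x hx y hy
      obtain ⟨p, hp, rfl⟩ := Finset.mem_image.1 hx
      obtain ⟨q, hq, rfl⟩ := Finset.mem_image.1 hy
      rw [Int.natAbs_dvd]
      refine hcop.dvd_of_dvd_mul_left (y := b) ⟨p.2 - q.2, ?_⟩
      linarith [(hmem p hp).2, (hmem q hq).2]
  have hsum : (S.card : ℝ) = ∑ c ∈ S.image t, ((S.filter fun p => t p = c).card : ℝ) := by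
    exact_mod_cast Finset.card_eq_sum_card_image t S
  rw [crossCount, ← hS, hsum]
  refine (Finset.sum_le_sum hfib).trans ?_
  rw [Finset.sum_const, nsmul_eq_mul]
  gcongr

/-- The bound for the number of solutions of a linear congruence in a box. -/
noncomputable def crossBound (m n a b : ℕ) : ℝ :=
  4 * n ^ 2 / m * (a.gcd b).gcd m + 4 * n / m * (max a b : ℕ) +
    n * ((a.gcd b : ℝ) / (max a b : ℕ)) + 1

theorem crossBound_comm (m n a b : ℕ) : crossBound m n a b = crossBound m n b a := by
  rw [crossBound, crossBound, Nat.gcd_comm a b, max_comm a b]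

/-- With `g = gcd(a, b)` and `k = gcd(g, m)`, dividing out `g` leaves a coprime pair and the modulus
`m/k`; the bound is the expanded product of the coprime case. -/
theorem crossCount_le_of_abs_le {m : ℕ} (hm : 0 < m) (n : ℕ) {a b : ℤ} (ha : a ≠ 0)
    (hab : b.natAbs ≤ a.natAbs) :
    (crossCount m n a b : ℝ) ≤ crossBound m n a.natAbs b.natAbs := by
  set g := Int.gcd a b with hg
  have hg0 : 0 < g := Int.gcd_pos_of_ne_zero_left _ ha
  obtain ⟨a', ha'⟩ : (g : ℤ) ∣ a := Int.gcd_dvd_left ..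
  obtain ⟨b', hb'⟩ : (g : ℤ) ∣ b := Int.gcd_dvd_right ..
  have hcop : IsCoprime a' b' := by
    rw [Int.isCoprime_iff_gcd_eq_one]
    have h := hg
    rw [ha', hb', Int.gcd_mul_left, Int.natAbs_natCast] at h
    exact Nat.eq_of_mul_eq_mul_left hg0 (by rw [← h, mul_one])
  have ha0 : a' ≠ 0 := by rintro rfl; simp at ha'; exact ha ha'
  set k := g.gcd m with hk
  have hk0 : 0 < k := Nat.gcd_pos_of_pos_left _ hg0
  obtain ⟨m', hm'⟩ : k ∣ m := Nat.gcd_dvd_right ..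
  obtain ⟨g', hg'⟩ : k ∣ g := Nat.gcd_dvd_left ..
  have hm0 : 0 < m' := Nat.pos_of_ne_zero (by rintro rfl; simp at hm'; omega)
  have hcop' : IsCoprime (m' : ℤ) (g' : ℤ) := by
    rw [Nat.isCoprime_iff_coprime, Nat.coprime_comm]
    have h := hk
    rw [hg', hm', Nat.gcd_mul_left] at h
    exact Nat.eq_of_mul_eq_mul_left hk0 (by rw [← h, mul_one])
  have hle : crossCount m n a b ≤ crossCount m' n a' b' := by
    refine Finset.card_le_card (Finset.monotone_filter_right _ ?_)
    intro p _ hp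
    rw [ha', hb', hg', hm'] at hp
    push_cast at hp
    have hkz : (k : ℤ) ≠ 0 := by exact_mod_cast hk0.ne'
    refine hcop'.dvd_of_dvd_mul_left (y := (g' : ℤ)) ?_
    refine (mul_dvd_mul_iff_left hkz).1 ?_
    have e : (k : ℤ) * (g' * (a' * p.2 - b' * p.1)) = k * g' * a' * p.2 - k * g' * b' * p.1 := by
      ring
    rwa [e]
  have hab' : |b'| ≤ |a'| := by
    have : |b| ≤ |a| := by
      rw [Int.abs_eq_natAbs, Int.abs_eq_natAbs]; exact_mod_cast hab
    rw [ha', hb', abs_mul, abs_mul] at this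
    exact le_of_mul_le_mul_left this (abs_pos.2 (by exact_mod_cast hg0.ne'))
  have hmain := crossCount_le_of_isCoprime hm0 n ha0 hab' hcop
  have hle' : (crossCount m n a b : ℝ) ≤ crossCount m' n a' b' := by exact_mod_cast hle
  refine (hle'.trans hmain).trans ?_
  have hgg : a.natAbs.gcd b.natAbs = g := rfl
  rw [crossBound, max_eq_left hab, hgg, ← hk]
  have haR : (0 : ℝ) < |(a' : ℝ)| := abs_pos.2 (by exact_mod_cast ha0)
  have hgR : (0 : ℝ) < g := by exact_mod_cast hg0
  have hkR : (0 : ℝ) < k := by exact_mod_cast hk0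
  have hmR : (0 : ℝ) < m' := by exact_mod_cast hm0
  have hkg : (k : ℝ) ≤ g := by exact_mod_cast Nat.gcd_le_left _ hg0
  have e1 : ((a.natAbs : ℕ) : ℝ) = g * |(a' : ℝ)| := by
    rw [Nat.cast_natAbs, ha']
    push_cast
    rw [abs_mul, Nat.abs_cast]
  have e2 : (m : ℝ) = k * m' := by exact_mod_cast hm'
  rw [e1, e2]
  have t1 : 4 * (n : ℝ) ^ 2 / (k * m') * k = 4 * n ^ 2 / m' := by field_simp
  have t2 : 4 * (n : ℝ) * |(a' : ℝ)| / m' ≤ 4 * n / (k * m') * (g * |(a' : ℝ)|) := by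
    rw [div_mul_eq_mul_div, div_le_div_iff₀ hmR (by positivity)]
    have : (0 : ℝ) ≤ 4 * n * |(a' : ℝ)| * m' := by positivity
    nlinarith
  have t3 : (n : ℝ) * (g / (g * |(a' : ℝ)|)) = n / |(a' : ℝ)| := by field_simp
  have t4 : 4 * (n : ℝ) * |(a' : ℝ)| / m' * (n / |(a' : ℝ)|) = 4 * n ^ 2 / m' := by field_simp
  rw [t1, t3]
  calc (4 * (n : ℝ) * |(a' : ℝ)| / m' + 1) * (n / |(a' : ℝ)| + 1)
      = 4 * (n : ℝ) * |(a' : ℝ)| / m' * (n / |(a' : ℝ)|) + 4 * (n : ℝ) * |(a' : ℝ)| / m' +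
        n / |(a' : ℝ)| + 1 := by ring
    _ ≤ _ := by rw [t4]; gcongr

theorem crossCount_le {m : ℕ} (hm : 0 < m) (n : ℕ) {a b : ℤ} (ha : a ≠ 0) (hb : b ≠ 0) :
    (crossCount m n a b : ℝ) ≤ crossBound m n a.natAbs b.natAbs := by
  rcases le_total b.natAbs a.natAbs with h | h
  · exact crossCount_le_of_abs_le hm n ha h
  · rw [crossCount_comm, crossBound_comm]
    exact crossCount_le_of_abs_le hm n hb h

/-! ### Weighted averages of gcd and max. -/

theorem Nat.totient_mul_le (d k : ℕ) : Nat.totient (d * k) ≤ d * Nat.totient k := by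
  induction d using Nat.recOnMul generalizing k with
  | zero => simp
  | one => simp
  | prime p hp =>
    by_cases h : p ∣ k
    · rw [Nat.totient_mul_of_prime_of_dvd hp h]
    · rw [Nat.totient_mul_of_prime_of_not_dvd hp h]
      exact Nat.mul_le_mul_right _ (Nat.sub_le _ _)
  | mul a b ha hb =>
    rw [mul_assoc, mul_assoc]
    exact (ha _).trans (Nat.mul_le_mul_left _ (hb _))

/-- Sum `φ(m)/d ≤ φ(m/d)` over `d ∣ m` and use `∑ φ(m/d) = m`. -/
theorem Nat.sum_divisors_inv_le_div_totient {m : ℕ} (hm : 0 < m) :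
    ∑ d ∈ m.divisors, (d : ℝ)⁻¹ ≤ m / m.totient := by
  have hφ : (0 : ℝ) < m.totient := by exact_mod_cast Nat.totient_pos.2 hm
  rw [le_div_iff₀ hφ, Finset.sum_mul]
  have hsum : ∑ d ∈ m.divisors, ((m / d).totient : ℝ) = m := by
    have h1 := Nat.sum_div_divisors m (fun d => (d.totient : ℝ))
    rw [h1]
    exact_mod_cast Nat.sum_totient m
  refine le_trans (Finset.sum_le_sum fun d hd => ?_) hsum.le
  have hd0 : (0 : ℝ) < d := by exact_mod_cast Nat.pos_of_mem_divisors hd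
  rw [inv_mul_le_iff₀ hd0]
  have h := Nat.totient_mul_le d (m / d)
  rw [Nat.mul_div_cancel' (Nat.dvd_of_mem_divisors hd)] at h
  exact_mod_cast h

theorem sum_inv_Icc_le (m : ℕ) : ∑ d ∈ Finset.Icc 1 m, (d : ℝ)⁻¹ ≤ 1 + Real.log m := by
  have h := harmonic_le_one_add_log m
  rwa [harmonic_eq_sum_Icc, Rat.cast_sum, Finset.sum_congr rfl fun i _ => by
    rw [Rat.cast_inv, Rat.cast_natCast]] at h

theorem sum_fejerWeight_mul_le {H : ℝ} (hH : 0 < H) {d : ℕ} (hd : 0 < d) (K : ℕ) :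
    ∑ k ∈ Finset.Icc 1 K, fejerWeight H (d * k) ≤ 4 * H / d := by
  have hd' : (0 : ℝ) < d := by exact_mod_cast hd
  set u := H / d with hu
  have hu0 : 0 < u := by positivity
  -- A telescoping majorant of `min(1, u²/(k+1)²)`, whose total is at most `4u`.
  have hterm : ∀ k : ℕ, fejerWeight H (d * (k + 1)) ≤
      4 * u ^ 2 * (1 / (u + k) - 1 / (u + (k + 1 : ℕ))) := by
    intro k
    have hk : (0 : ℝ) ≤ k := by positivity
    have h1 : 4 * u ^ 2 * (1 / (u + k) - 1 / (u + (k + 1 : ℕ))) =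
        4 * u ^ 2 / ((u + k) * (u + k + 1)) := by
      push_cast
      field_simp
      ring
    rw [h1, fejerWeight]
    have h2 : H ^ 2 / ((d * (k + 1) : ℕ) : ℝ) ^ 2 = u ^ 2 / ((k : ℝ) + 1) ^ 2 := by
      rw [hu]; push_cast; field_simp
    rw [h2]
    rcases le_total u (k + 1) with h | h
    · refine (min_le_right _ _).trans ?_
      rw [div_le_div_iff₀ (by positivity) (by positivity)]
      have : (u + k) * (u + k + 1) ≤ 4 * ((k : ℝ) + 1) ^ 2 := by nlinarith
      nlinarith [sq_nonneg u]
    · refine (min_le_left _ _).trans ?_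
      rw [le_div_iff₀ (by positivity)]
      nlinarith
  have hind : ∑ k ∈ Finset.Icc 1 K, fejerWeight H (d * k) ≤
      4 * u ^ 2 * (1 / u - 1 / (u + K)) := by
    induction K with
    | zero => simp
    | succ K ih =>
      rw [Finset.sum_Icc_succ_top (by omega)]
      linarith [hterm K]
  refine hind.trans ?_
  have : 0 ≤ 1 / (u + (K : ℝ)) := by positivity
  calc 4 * u ^ 2 * (1 / u - 1 / (u + K)) ≤ 4 * u ^ 2 * (1 / u) := by gcongr; linarith
    _ = 4 * H / d := by rw [hu]; field_simp

theorem sum_fejerWeight_dvd_le {H : ℝ} (hH : 0 < H) {d : ℕ} (hd : 0 < d) (m : ℕ) :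
    ∑ a ∈ (Finset.Icc 1 m).filter (d ∣ ·), fejerWeight H a ≤ 4 * H / d := by
  have hsub : (Finset.Icc 1 m).filter (d ∣ ·) ⊆ (Finset.Icc 1 m).image (d * ·) := by
    intro a ha
    simp only [Finset.mem_filter, Finset.mem_Icc] at ha
    obtain ⟨k, rfl⟩ := ha.2
    refine Finset.mem_image.2 ⟨k, Finset.mem_Icc.2 ⟨?_, ?_⟩, rfl⟩
    · exact Nat.pos_of_ne_zero (by rintro rfl; simp at ha)
    · exact (Nat.le_mul_of_pos_left k hd).trans ha.1.2
  refine (Finset.sum_le_sum_of_subset_of_nonneg hsub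
    fun _ _ _ => fejerWeight_nonneg _ _).trans ?_
  rw [Finset.sum_image fun x _ y _ h => Nat.eq_of_mul_eq_mul_left hd h]
  exact sum_fejerWeight_mul_le hH hd m

theorem sum_fejerWeight_le {H : ℝ} (hH : 0 < H) (m : ℕ) :
    ∑ a ∈ Finset.Icc 1 m, fejerWeight H a ≤ 4 * H := by
  simpa using sum_fejerWeight_mul_le hH one_pos m

/-- The gcd is bounded by the sum of the common divisors `d` of `a`, `b`, `m`. For fixed `d` the
double sum is the square of a single one, so `d (4H/d)²` remains. This is the origin of `m/φ(m)`. -/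
theorem sum_fejerWeight_mul_gcd_le {H : ℝ} (hH : 0 < H) {m : ℕ} (hm : 0 < m) :
    ∑ a ∈ Finset.Icc 1 m, ∑ b ∈ Finset.Icc 1 m,
      fejerWeight H a * fejerWeight H b * ((a.gcd b).gcd m : ℕ) ≤
      16 * H ^ 2 * (m / m.totient) := by
  have hpt : ∀ a b : ℕ, fejerWeight H a * fejerWeight H b * ((a.gcd b).gcd m : ℕ) ≤
      ∑ d ∈ m.divisors, (d : ℝ) * ((if d ∣ a then fejerWeight H a else 0) *
        (if d ∣ b then fejerWeight H b else 0)) := by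
    intro a b
    have hmem : (a.gcd b).gcd m ∈ m.divisors :=
      Nat.mem_divisors.2 ⟨Nat.gcd_dvd_right _ _, hm.ne'⟩
    refine le_trans (le_of_eq ?_) (Finset.single_le_sum (fun d _ => ?_) hmem)
    · rw [if_pos ((Nat.gcd_dvd_left _ _).trans (Nat.gcd_dvd_left _ _)),
        if_pos ((Nat.gcd_dvd_left _ _).trans (Nat.gcd_dvd_right _ _))]
      ring
    · have := fejerWeight_nonneg H a
      have := fejerWeight_nonneg H b
      split_ifs <;> positivity
  calc _ ≤ ∑ a ∈ Finset.Icc 1 m, ∑ b ∈ Finset.Icc 1 m, ∑ d ∈ m.divisors,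
        (d : ℝ) * ((if d ∣ a then fejerWeight H a else 0) *
        (if d ∣ b then fejerWeight H b else 0)) :=
        Finset.sum_le_sum fun a _ => Finset.sum_le_sum fun b _ => hpt a b
    _ = ∑ d ∈ m.divisors, (d : ℝ) *
        (∑ a ∈ (Finset.Icc 1 m).filter (d ∣ ·), fejerWeight H a) ^ 2 := by
        simp_rw [Finset.sum_comm (s := Finset.Icc 1 m) (t := m.divisors)]
        refine Finset.sum_congr rfl fun d _ => ?_
        rw [sq, Finset.sum_filter, Finset.sum_mul_sum, Finset.mul_sum]
        exact Finset.sum_congr rfl fun a _ => (Finset.mul_sum _ _ _).symm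
    _ ≤ ∑ d ∈ m.divisors, (d : ℝ) * (4 * H / d) ^ 2 := by
        refine Finset.sum_le_sum fun d hd => ?_
        gcongr
        · exact Finset.sum_nonneg fun _ _ => fejerWeight_nonneg _ _
        · exact sum_fejerWeight_dvd_le hH (Nat.pos_of_mem_divisors hd) m
    _ = 16 * H ^ 2 * ∑ d ∈ m.divisors, (d : ℝ)⁻¹ := by
        rw [Finset.mul_sum]
        refine Finset.sum_congr rfl fun d hd => ?_
        have : (0 : ℝ) < d := by exact_mod_cast Nat.pos_of_mem_divisors hd
        field_simp
        norm_num
    _ ≤ _ := by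
        gcongr
        exact Nat.sum_divisors_inv_le_div_totient hm

/-- Use `max a b ≤ a + b`; the quadratic decay of the weight turns `∑ w(a) a` into `H²` times a
harmonic sum. -/
theorem sum_fejerWeight_mul_max_le {H : ℝ} (hH : 0 < H) (m : ℕ) :
    ∑ a ∈ Finset.Icc 1 m, ∑ b ∈ Finset.Icc 1 m,
      fejerWeight H a * fejerWeight H b * (max a b : ℕ) ≤ 8 * H ^ 3 * (1 + Real.log m) := by
  have hlog : ∑ a ∈ Finset.Icc 1 m, fejerWeight H a * a ≤ H ^ 2 * (1 + Real.log m) := by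
    refine le_trans (Finset.sum_le_sum fun a ha => ?_)
      ((Finset.mul_sum (Finset.Icc 1 m) (fun d : ℕ => (d : ℝ)⁻¹) (H ^ 2)).symm.le.trans
        (by gcongr; exact sum_inv_Icc_le m))
    have ha0 : (0 : ℝ) < a := by exact_mod_cast (Finset.mem_Icc.1 ha).1
    calc fejerWeight H a * a ≤ H ^ 2 / (a : ℝ) ^ 2 * a := by gcongr; exact min_le_right _ _
      _ = _ := by field_simp
  have hw := sum_fejerWeight_le hH m
  have hw0 : 0 ≤ ∑ a ∈ Finset.Icc 1 m, fejerWeight H a :=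
    Finset.sum_nonneg fun _ _ => fejerWeight_nonneg _ _
  have hlog0 : 0 ≤ ∑ a ∈ Finset.Icc 1 m, fejerWeight H a * a :=
    Finset.sum_nonneg fun _ _ => mul_nonneg (fejerWeight_nonneg _ _) (Nat.cast_nonneg _)
  calc _ ≤ ∑ a ∈ Finset.Icc 1 m, ∑ b ∈ Finset.Icc 1 m, (fejerWeight H a * a * fejerWeight H b +
        fejerWeight H a * (fejerWeight H b * b)) := by
        refine Finset.sum_le_sum fun a _ => Finset.sum_le_sum fun b _ => ?_
        have h1 := fejerWeight_nonneg H a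
        have h2 := fejerWeight_nonneg H b
        have h3 : ((max a b : ℕ) : ℝ) ≤ a + b := by
          exact_mod_cast max_le (Nat.le_add_right _ _) (Nat.le_add_left _ _)
        calc fejerWeight H a * fejerWeight H b * (max a b : ℕ) ≤
            fejerWeight H a * fejerWeight H b * (a + b) := by gcongr
          _ = _ := by ring
    _ = 2 * ((∑ a ∈ Finset.Icc 1 m, fejerWeight H a * a) *
          ∑ b ∈ Finset.Icc 1 m, fejerWeight H b) := by
        simp_rw [Finset.sum_add_distrib]
        rw [← Finset.sum_mul_sum, ← Finset.sum_mul_sum]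
        ring
    _ ≤ 2 * (H ^ 2 * (1 + Real.log m) * (4 * H)) := by gcongr
    _ = _ := by ring

/-- Bound the gcd by the sum of the common divisors; each `d ∣ a` divides `a/d` of the `b`, so it
contributes at most `a`. -/
theorem sum_gcd_div_le (m : ℕ) {a : ℕ} (ha : a ∈ Finset.Icc 1 m) :
    ∑ b ∈ Finset.Icc 1 a, (a.gcd b : ℝ) / a ≤ ((Finset.Icc 1 m).filter (· ∣ a)).card := by
  rw [Finset.mem_Icc] at ha
  have ha0 : (0 : ℝ) < a := by exact_mod_cast ha.1
  rw [← Finset.sum_div, div_le_iff₀ ha0]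
  norm_cast
  calc ∑ b ∈ Finset.Icc 1 a, a.gcd b ≤ ∑ b ∈ Finset.Icc 1 a,
        ∑ d ∈ (Finset.Icc 1 m).filter (· ∣ a), if d ∣ b then d else 0 := by
        refine Finset.sum_le_sum fun b _ => ?_
        have hmem : a.gcd b ∈ (Finset.Icc 1 m).filter (· ∣ a) := by
          simp only [Finset.mem_filter, Finset.mem_Icc]
          exact ⟨⟨Nat.gcd_pos_of_pos_left _ ha.1, (Nat.gcd_le_left _ ha.1).trans ha.2⟩,
            Nat.gcd_dvd_left _ _⟩
        refine le_trans (le_of_eq ?_) (Finset.single_le_sum (fun d _ => Nat.zero_le _) hmem)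
        rw [if_pos (Nat.gcd_dvd_right _ _)]
    _ = ∑ d ∈ (Finset.Icc 1 m).filter (· ∣ a), a / d * d := by
        rw [Finset.sum_comm]
        refine Finset.sum_congr rfl fun d _ => ?_
        rw [← Finset.sum_filter, Finset.sum_const, smul_eq_mul]
        congr 1
        exact Nat.Ioc_filter_dvd_card_eq_div a d
    _ ≤ ∑ d ∈ (Finset.Icc 1 m).filter (· ∣ a), a :=
        Finset.sum_le_sum fun d _ => Nat.div_mul_le_self a d
    _ = _ := by rw [Finset.sum_const, smul_eq_mul]

/-- By symmetry take `b ≤ a` and drop the weight of `b`. Summing over `b` leaves the number of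
divisors of `a`, and exchanging the sums gives `∑ 4H/d`. -/
theorem sum_fejerWeight_mul_gcd_div_max_le {H : ℝ} (hH : 0 < H) (m : ℕ) :
    ∑ a ∈ Finset.Icc 1 m, ∑ b ∈ Finset.Icc 1 m,
      fejerWeight H a * fejerWeight H b * ((a.gcd b : ℝ) / (max a b : ℕ)) ≤
      8 * H * (1 + Real.log m) := by
  let G : ℕ → ℕ → ℝ := fun a b => if b ≤ a then fejerWeight H a * ((a.gcd b : ℝ) / a) else 0
  have hG0 : ∀ a b, 0 ≤ G a b := fun a b => by
    have := fejerWeight_nonneg H a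
    simp only [G]
    split_ifs <;> positivity
  have hpt : ∀ a b : ℕ, fejerWeight H a * fejerWeight H b * ((a.gcd b : ℝ) / (max a b : ℕ)) ≤
      G a b + G b a := by
    have haux : ∀ a b : ℕ, b ≤ a →
        fejerWeight H a * fejerWeight H b * ((a.gcd b : ℝ) / (max a b : ℕ)) ≤ G a b := by
      intro a b h
      have h1 := fejerWeight_nonneg H a
      simp only [G, if_pos h, max_eq_left h]
      gcongr
      exact mul_le_of_le_one_right h1 (fejerWeight_le_one _ _)
    intro a b
    rcases le_total b a with h | h
    · exact (haux a b h).trans (le_add_of_nonneg_right (hG0 b a))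
    · rw [mul_comm (fejerWeight H a), Nat.gcd_comm, max_comm]
      exact (haux b a h).trans (le_add_of_nonneg_left (hG0 a b))
  have hS : ∑ a ∈ Finset.Icc 1 m, ∑ b ∈ Finset.Icc 1 m, G a b ≤ 4 * H * (1 + Real.log m) := by
    calc _ ≤ ∑ a ∈ Finset.Icc 1 m, fejerWeight H a *
          (((Finset.Icc 1 m).filter (· ∣ a)).card : ℝ) := by
          refine Finset.sum_le_sum fun a ha => ?_
          simp only [G]
          rw [← Finset.sum_filter, ← Finset.mul_sum]
          refine mul_le_mul_of_nonneg_left (le_trans (le_of_eq ?_) (sum_gcd_div_le m ha))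
            (fejerWeight_nonneg _ _)
          refine Finset.sum_congr ?_ fun _ _ => rfl
          ext b
          simp only [Finset.mem_filter, Finset.mem_Icc] at ha ⊢
          omega
      _ = ∑ d ∈ Finset.Icc 1 m, ∑ a ∈ (Finset.Icc 1 m).filter (d ∣ ·), fejerWeight H a := by
          simp_rw [Finset.sum_filter]
          rw [Finset.sum_comm]
          refine Finset.sum_congr rfl fun a _ => ?_
          rw [← Finset.sum_filter, Finset.sum_const, nsmul_eq_mul, mul_comm]
      _ ≤ ∑ d ∈ Finset.Icc 1 m, 4 * H * (d : ℝ)⁻¹ :=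
          Finset.sum_le_sum fun d hd => sum_fejerWeight_dvd_le hH (Finset.mem_Icc.1 hd).1 m
      _ ≤ _ := by
          rw [← Finset.mul_sum]
          gcongr
          exact sum_inv_Icc_le m
  calc _ ≤ ∑ a ∈ Finset.Icc 1 m, ∑ b ∈ Finset.Icc 1 m, (G a b + G b a) :=
        Finset.sum_le_sum fun a _ => Finset.sum_le_sum fun b _ => hpt a b
    _ = 2 * ∑ a ∈ Finset.Icc 1 m, ∑ b ∈ Finset.Icc 1 m, G a b := by
        simp_rw [Finset.sum_add_distrib]
        rw [Finset.sum_comm (f := fun a b => G b a)]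
        ring
    _ ≤ _ := by linarith

/-! ### The second moment over frequencies. -/

/-- The average of the solution counts of linear congruences, weighted by Fejér weights. -/
noncomputable def crossTotal (m n : ℕ) (H : ℝ) : ℝ :=
  4 * n ^ 2 / m * (16 * H ^ 2 * (m / m.totient)) +
    4 * n / m * (8 * H ^ 3 * (1 + Real.log m)) + n * (8 * H * (1 + Real.log m)) + 16 * H ^ 2

theorem sum_fejerWeight_mul_crossBound_le {H : ℝ} (hH : 0 < H) {m : ℕ} (hm : 0 < m) (n : ℕ) :
    ∑ a ∈ Finset.Icc 1 m, ∑ b ∈ Finset.Icc 1 m,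
      fejerWeight H a * fejerWeight H b * crossBound m n a b ≤ crossTotal m n H := by
  have h1 := sum_fejerWeight_mul_gcd_le hH hm
  have h2 := sum_fejerWeight_mul_max_le hH m
  have h3 := sum_fejerWeight_mul_gcd_div_max_le hH m
  have h4 : ∑ a ∈ Finset.Icc 1 m, ∑ b ∈ Finset.Icc 1 m,
      fejerWeight H a * fejerWeight H b ≤ 16 * H ^ 2 := by
    rw [← Finset.sum_mul_sum]
    have hw := sum_fejerWeight_le hH m
    have hw0 : 0 ≤ ∑ a ∈ Finset.Icc 1 m, fejerWeight H a :=
      Finset.sum_nonneg fun _ _ => fejerWeight_nonneg _ _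
    nlinarith
  have hexp : ∀ a b : ℕ, fejerWeight H a * fejerWeight H b * crossBound m n a b =
      4 * n ^ 2 / m * (fejerWeight H a * fejerWeight H b * ((a.gcd b).gcd m : ℕ)) +
      4 * n / m * (fejerWeight H a * fejerWeight H b * (max a b : ℕ)) +
      n * (fejerWeight H a * fejerWeight H b * ((a.gcd b : ℝ) / (max a b : ℕ))) +
      fejerWeight H a * fejerWeight H b := by
    intro a b
    rw [crossBound]
    ring
  simp_rw [← Finset.mul_sum] at h4
  simp_rw [hexp, Finset.sum_add_distrib, ← Finset.mul_sum]
  rw [crossTotal]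
  gcongr

/-- Only `a` and `-a` have least absolute residue of size `a`. -/
theorem ZMod.sum_natAbs_valMinAbs_le {m : ℕ} [NeZero m] (F : ℕ → ℝ) (hF : ∀ a, 0 ≤ F a) :
    ∑ u ∈ Finset.univ.erase (0 : ZMod m), F u.valMinAbs.natAbs ≤
      2 * ∑ a ∈ Finset.Icc 1 m, F a := by
  have hmaps : ∀ u ∈ Finset.univ.erase (0 : ZMod m),
      u.valMinAbs.natAbs ∈ Finset.Icc 1 m := by
    intro u hu
    rw [Finset.mem_Icc]
    refine ⟨Int.natAbs_pos.2 ((ZMod.valMinAbs_eq_zero u).not.2 (Finset.ne_of_mem_erase hu)), ?_⟩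
    exact (ZMod.natAbs_valMinAbs_le u).trans (Nat.div_le_self _ _)
  rw [← Finset.sum_fiberwise_of_maps_to hmaps, Finset.mul_sum]
  refine Finset.sum_le_sum fun a _ => ?_
  set S := (Finset.univ.erase (0 : ZMod m)).filter fun u => u.valMinAbs.natAbs = a
  have hcard : S.card ≤ 2 := by
    refine (Finset.card_le_card (t := {(a : ZMod m), -(a : ZMod m)}) ?_).trans Finset.card_le_two
    intro u hu
    have ha := (Finset.mem_filter.1 hu).2
    simp only [Finset.mem_insert, Finset.mem_singleton]
    rcases Int.natAbs_eq u.valMinAbs with h | h <;> rw [ha] at h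
    · left
      rw [← ZMod.coe_valMinAbs u, h, Int.cast_natCast]
    · right
      rw [← ZMod.coe_valMinAbs u, h, Int.cast_neg, Int.cast_natCast]
  have heq : ∀ u ∈ S, F u.valMinAbs.natAbs = F a := fun u hu => by
    rw [(Finset.mem_filter.1 hu).2]
  rw [Finset.sum_congr rfl heq, Finset.sum_const, nsmul_eq_mul]
  exact mul_le_mul_of_nonneg_right (by exact_mod_cast hcard) (hF a)

theorem crossBound_nonneg (m n a b : ℕ) : 0 ≤ crossBound m n a b := by
  rw [crossBound]
  positivity

/-- Expand the square and send `(h, x, y)` to `(hx, hy, x, y)`. This is injective because `x` is a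
unit, and its image satisfies the cross congruence; enlarging to all its solutions loses only
positive terms. -/
theorem sum_sq_sum_fejerWeight_le {m : ℕ} [NeZero m] {H : ℝ} (hH : 0 < H) (n : ℕ) (X : Finset ℕ)
    (hX : ∀ x ∈ X, x.Coprime m) (hXn : ∀ x ∈ X, x ∈ Finset.Icc 1 n) :
    ∑ h ∈ Finset.univ.erase (0 : ZMod m), (∑ x ∈ X, fejerWeight H (h * x).valMinAbs.natAbs) ^ 2 ≤
      4 * crossTotal m n H := by
  have hm : 0 < m := Nat.pos_of_ne_zero (NeZero.ne m)
  set E := Finset.univ.erase (0 : ZMod m) with hE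
  let w : ZMod m → ℝ := fun u => fejerWeight H u.valMinAbs.natAbs
  have hw0 : ∀ u, 0 ≤ w u := fun u => fejerWeight_nonneg _ _
  let e : ZMod m × ℕ × ℕ → (ZMod m × ZMod m) × ℕ × ℕ := fun t =>
    ((t.1 * t.2.1, t.1 * t.2.2), t.2)
  let g : (ZMod m × ZMod m) × ℕ × ℕ → ℝ := fun t => w t.1.1 * w t.1.2
  set s := E ×ˢ X ×ˢ X with hs
  set T := ((E ×ˢ E) ×ˢ (Finset.Icc 1 n ×ˢ Finset.Icc 1 n)).filter
    fun t : (ZMod m × ZMod m) × ℕ × ℕ =>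
      (m : ℤ) ∣ t.1.1.valMinAbs * t.2.2 - t.1.2.valMinAbs * t.2.1 with hT
  have hunit : ∀ x ∈ X, IsUnit (x : ZMod m) := fun x hx =>
    (ZMod.isUnit_iff_coprime x m).2 (hX x hx)
  have hinj : Set.InjOn e s := by
    rintro ⟨h, x, y⟩ hh ⟨h', x', y'⟩ _ heq
    simp only [e, Prod.mk.injEq] at heq
    obtain ⟨⟨h1, -⟩, rfl, rfl⟩ := heq
    rw [hs, Finset.mem_coe, Finset.mem_product, Finset.mem_product] at hh
    rw [(hunit x hh.2.1).mul_right_cancel h1]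
  have hmaps : s.image e ⊆ T := by
    intro t ht
    obtain ⟨⟨h, x, y⟩, hh, rfl⟩ := Finset.mem_image.1 ht
    rw [hs, Finset.mem_product, Finset.mem_product] at hh
    have hne : ∀ z ∈ X, h * z ∈ E := fun z hz => by
      refine Finset.mem_erase.2 ⟨fun h0 => ?_, Finset.mem_univ _⟩
      exact Finset.ne_of_mem_erase hh.1 ((hunit z hz).mul_left_eq_zero.1 h0)
    rw [hT, Finset.mem_filter, Finset.mem_product, Finset.mem_product, Finset.mem_product]
    refine ⟨⟨⟨hne x hh.2.1, hne y hh.2.2⟩, hXn x hh.2.1, hXn y hh.2.2⟩, ?_⟩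
    rw [← ZMod.intCast_zmod_eq_zero_iff_dvd]
    simp only [e]
    push_cast [ZMod.coe_valMinAbs]
    ring
  have hdouble : ∑ u ∈ E, ∑ v ∈ E, w u * w v *
      crossBound m n u.valMinAbs.natAbs v.valMinAbs.natAbs ≤ 4 * crossTotal m n H := by
    have hnn : ∀ a b : ℕ, 0 ≤ fejerWeight H a * fejerWeight H b * crossBound m n a b := fun a b =>
      mul_nonneg (mul_nonneg (fejerWeight_nonneg _ _) (fejerWeight_nonneg _ _))
        (crossBound_nonneg _ _ _ _)
    calc _ ≤ ∑ u ∈ E, 2 * ∑ b ∈ Finset.Icc 1 m, w u * fejerWeight H b *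
          crossBound m n u.valMinAbs.natAbs b :=
          Finset.sum_le_sum fun u _ => ZMod.sum_natAbs_valMinAbs_le
            (fun b => fejerWeight H u.valMinAbs.natAbs * fejerWeight H b *
              crossBound m n u.valMinAbs.natAbs b) fun b => hnn _ b
      _ ≤ 2 * ∑ a ∈ Finset.Icc 1 m, 2 * ∑ b ∈ Finset.Icc 1 m,
          fejerWeight H a * fejerWeight H b * crossBound m n a b :=
          ZMod.sum_natAbs_valMinAbs_le (fun a => 2 * ∑ b ∈ Finset.Icc 1 m,
            fejerWeight H a * fejerWeight H b * crossBound m n a b) fun a =>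
              mul_nonneg two_pos.le (Finset.sum_nonneg fun b _ => hnn a b)
      _ = 4 * ∑ a ∈ Finset.Icc 1 m, ∑ b ∈ Finset.Icc 1 m,
          fejerWeight H a * fejerWeight H b * crossBound m n a b := by
          rw [← Finset.mul_sum]
          ring
      _ ≤ _ := by
          gcongr
          exact sum_fejerWeight_mul_crossBound_le hH hm n
  refine le_trans ?_ hdouble
  calc ∑ h ∈ E, (∑ x ∈ X, fejerWeight H (h * x).valMinAbs.natAbs) ^ 2
      = ∑ t ∈ s, g (e t) := by
        rw [hs, Finset.sum_product]
        refine Finset.sum_congr rfl fun h _ => ?_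
        rw [sq, Finset.sum_mul_sum, Finset.sum_product]
    _ = ∑ t ∈ s.image e, g t := (Finset.sum_image hinj).symm
    _ ≤ ∑ t ∈ T, g t := Finset.sum_le_sum_of_subset_of_nonneg hmaps
        fun t _ _ => mul_nonneg (hw0 _) (hw0 _)
    _ = ∑ u ∈ E, ∑ v ∈ E, w u * w v * crossCount m n u.valMinAbs v.valMinAbs := by
        rw [hT, Finset.sum_filter, Finset.sum_product, Finset.sum_product]
        refine Finset.sum_congr rfl fun u _ => Finset.sum_congr rfl fun v _ => ?_
        simp only [g]
        rw [← Finset.sum_filter, Finset.sum_const, nsmul_eq_mul, crossCount, mul_comm]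
    _ ≤ _ := by
        refine Finset.sum_le_sum fun u hu => Finset.sum_le_sum fun v hv => ?_
        refine mul_le_mul_of_nonneg_left ?_ (mul_nonneg (hw0 _) (hw0 _))
        exact crossCount_le hm n ((ZMod.valMinAbs_eq_zero u).not.2 (Finset.ne_of_mem_erase hu))
          ((ZMod.valMinAbs_eq_zero v).not.2 (Finset.ne_of_mem_erase hv))

/-! ### Primes in `[N/4, N]` coprime to `m`. -/

theorem eventually_log_sq_le_mul_rpow {δ c : ℝ} (hδ : 0 < δ) (hc : 0 < c) :
    ∀ᶠ x : ℝ in atTop, Real.log x ^ 2 ≤ c * x ^ δ := by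
  have h := (isLittleO_log_rpow_rpow_atTop (s := δ) 2 hδ).bound hc
  filter_upwards [h, eventually_ge_atTop 1] with x hx hx1
  have h0 := Real.log_nonneg hx1
  rw [Real.norm_of_nonneg (by positivity), Real.norm_of_nonneg (by positivity)] at hx
  exact_mod_cast hx

/-- A lower bound of Chebyshev type for the number of primes in `[N / 4, N]`. -/
theorem eventually_le_card_primes_mul_log : ∀ᶠ N : ℝ in atTop, N / 4 ≤
    (((Finset.Icc 1 ⌊N⌋₊).filter fun p : ℕ => p.Prime ∧ N / 4 ≤ (p : ℝ)).card : ℝ) * Real.log N := by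
  have h1 := eventually_log_sq_le_mul_rpow (δ := 1 / 2) (c := 1 / 100) (by norm_num) (by norm_num)
  filter_upwards [h1, eventually_ge_atTop 10000] with N hN1 hN
  rw [← Real.sqrt_eq_rpow] at hN1
  have hl1 : 1 ≤ Real.log N := by
    rw [Real.le_log_iff_exp_le (by linarith)]
    linarith [Real.exp_one_lt_d9]
  have hs0 : 0 < √N := Real.sqrt_pos.2 (by linarith)
  have hsq : √N * √N = N := Real.mul_self_sqrt (by linarith)
  have hs100 : 100 ≤ √N := Real.le_sqrt_of_sq_le (by linarith)
  have hlog : Real.log N ≤ √N / 100 := by nlinarith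
  have hlog2 : Real.log (N + 2) ≤ N / 100 := by
    have : Real.log (N + 2) ≤ 2 * Real.log N := by
      rw [← Real.log_rpow (by linarith)]
      refine Real.log_le_log (by linarith) ?_
      rw [Real.rpow_two]
      nlinarith
    nlinarith
  have hθ := Chebyshev.theta_ge' (x := N) (by linarith)
  have hθ' := Chebyshev.theta_le_log4_mul_x (x := N / 4) (by linarith)
  have hl4 : Real.log 4 = 2 * Real.log 2 := by
    rw [← Real.log_rpow two_pos]
    norm_num
  have hl2 := Real.log_two_gt_d9
  -- `θ(N/4)` is at most `(log 2 / 2) N`, half the main term `(log 2) N` of the lower bound for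
  -- `θ(N)`. The difference, about `0.346 N`, leaves room above `N/4` for the lower-order terms.
  have hdiff : N / 4 ≤ Chebyshev.theta N - Chebyshev.theta (N / 4) := by
    have : √N * Real.log N ≤ N / 100 := by nlinarith
    rw [hl4] at hθ'
    nlinarith
  refine hdiff.trans ?_
  set A := (Finset.Icc 1 ⌊N⌋₊).filter fun p : ℕ => p.Prime ∧ N / 4 ≤ (p : ℝ)
  have hsum : Chebyshev.theta N ≤ Chebyshev.theta (N / 4) + ∑ p ∈ A, Real.log p := by
    rw [Chebyshev.theta, Chebyshev.theta]
    refine (Finset.sum_le_sum_of_subset_of_nonneg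
      (t := (Finset.Ioc 0 ⌊N / 4⌋₊).filter Nat.Prime ∪ A) ?_ ?_).trans ?_
    · intro p hp
      simp only [A, Finset.mem_union, Finset.mem_filter, Finset.mem_Ioc, Finset.mem_Icc] at hp ⊢
      rcases le_total (N / 4) p with h | h
      · exact Or.inr ⟨hp.1, hp.2, h⟩
      · exact Or.inl ⟨⟨hp.1.1, Nat.le_floor h⟩, hp.2⟩
    · intro p _ _
      exact Real.log_natCast_nonneg p
    · rw [← Finset.sum_union_inter]
      exact le_add_of_nonneg_right (Finset.sum_nonneg fun p _ => Real.log_natCast_nonneg p)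
  have hA : ∑ p ∈ A, Real.log p ≤ A.card * Real.log N := by
    rw [← nsmul_eq_mul]
    refine Finset.sum_le_card_nsmul _ _ _ fun p hp => ?_
    simp only [A, Finset.mem_filter, Finset.mem_Icc] at hp
    refine Real.log_le_log (by exact_mod_cast hp.1.1) ?_
    exact (Nat.le_floor_iff (by linarith)).1 hp.1.2
  linarith

theorem card_primeFactors_mul_log_two_le {m : ℕ} (hm : 0 < m) :
    (m.primeFactors.card : ℝ) * Real.log 2 ≤ Real.log m := by
  have h : 2 ^ m.primeFactors.card ≤ m :=
    (Finset.pow_card_le_prod _ _ _ fun p hp => (Nat.prime_of_mem_primeFactors hp).two_le).trans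
      (Nat.le_of_dvd hm (Nat.prod_primeFactors_dvd m))
  rw [← Real.log_pow]
  exact Real.log_le_log (by positivity) (by exact_mod_cast h)

/-- A set of primes in `[N / 4, N]` coprime to `m`, of cardinality of order `N / log m`. -/
theorem eventually_exists_primes : ∀ᶠ m : ℕ in atTop, ∀ N : ℝ, √m ≤ N → N ≤ m →
    ∃ X : Finset ℕ, (∀ p ∈ X, p.Prime ∧ p.Coprime m ∧ N / 4 ≤ p ∧ (p : ℝ) ≤ N) ∧
      N / (8 * Real.log m) ≤ X.card ∧ (X.card : ℝ) ≤ N / (4 * Real.log m) := by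
  obtain ⟨N₀, hN₀⟩ := eventually_atTop.1 eventually_le_card_primes_mul_log
  have h1 := tendsto_natCast_atTop_atTop (R := ℝ) |>.eventually
    (eventually_log_sq_le_mul_rpow (δ := 1 / 2) (c := 1 / 100) (by norm_num) (by norm_num))
  have h2 := (tendsto_natCast_atTop_atTop (R := ℝ)).eventually
    (Real.tendsto_sqrt_atTop.eventually_ge_atTop N₀)
  filter_upwards [h1, h2, eventually_ge_atTop 3] with m hm1 hm2 hm3 N hN hNm
  have hm3' : (3 : ℝ) ≤ m := by exact_mod_cast hm3
  have hl1 : 1 ≤ Real.log m := by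
    rw [Real.le_log_iff_exp_le (by linarith)]
    linarith [Real.exp_one_lt_d9]
  rw [← Real.sqrt_eq_rpow] at hm1
  have hNpos : 0 < N := lt_of_lt_of_le (Real.sqrt_pos.2 (by linarith)) hN
  have hA := hN₀ N (hm2.trans hN)
  set A := (Finset.Icc 1 ⌊N⌋₊).filter fun p : ℕ => p.Prime ∧ N / 4 ≤ (p : ℝ)
  have hA' : N / 4 ≤ A.card * Real.log m :=
    hA.trans (mul_le_mul_of_nonneg_left (Real.log_le_log hNpos hNm) (Nat.cast_nonneg _))
  have hω := card_primeFactors_mul_log_two_le (m := m) (by omega)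
  have hl2 := Real.log_two_gt_d9
  have hω0 : (0 : ℝ) ≤ m.primeFactors.card := Nat.cast_nonneg _
  have hω' : (m.primeFactors.card : ℝ) ≤ 2 * Real.log m := by nlinarith
  have hsd : (A.card : ℝ) ≤ (A \ m.primeFactors).card + m.primeFactors.card := by
    exact_mod_cast (Finset.card_le_card_sdiff_add_card (s := A) (t := m.primeFactors))
  -- Discarding at most `2 log m` prime factors costs at most half of `A`, since `N ≥ √m ≥ 100 log²
  -- m`.
  have hlow : N / (8 * Real.log m) ≤ (A \ m.primeFactors).card := by
    rw [div_le_iff₀ (by positivity)]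
    nlinarith
  -- Trimming to exactly `⌈N / (8 log m)⌉` primes gives the upper bound on `X.card` that limits the
  -- pairs with `p ∣ y`.
  obtain ⟨X, hXA, hX⟩ := Finset.exists_subset_card_eq (Nat.ceil_le.2 hlow)
  refine ⟨X, fun p hp => ?_, ?_, ?_⟩
  · have hpA := Finset.mem_sdiff.1 (hXA hp)
    simp only [A, Finset.mem_filter, Finset.mem_Icc] at hpA
    refine ⟨hpA.1.2.1, (Nat.Prime.coprime_iff_not_dvd hpA.1.2.1).2 fun hdvd => hpA.2 ?_,
      hpA.1.2.2, (Nat.le_floor_iff hNpos.le).1 hpA.1.1.2⟩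
    exact Nat.mem_primeFactors.2 ⟨hpA.1.2.1, hdvd, by omega⟩
  · rw [hX]
    exact Nat.le_ceil _
  · rw [hX]
    have hone : 1 ≤ N / (8 * Real.log m) := by
      rw [le_div_iff₀ (by positivity)]
      nlinarith
    have := (Nat.ceil_lt_add_one (zero_le_one.trans hone)).le
    have e : N / (4 * Real.log m) = 2 * (N / (8 * Real.log m)) := by
      field_simp
      norm_num
    linarith

/-! ### Removing non-coprime pairs and assembling the bound. -/

/-- The number of classes not represented by a product of coprime `x ∈ X` and `y` in an interval of
length `2 L`, when `X` consists of primes. -/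
theorem le_ncard_coprimeProductClasses {m : ℕ} [NeZero m] {N S Y : ℝ} (hN : 0 < N) {L : ℕ}
    (hL : 0 < L) (hLY : 2 * (L : ℝ) ≤ Y) (X : Finset ℕ)
    (hX : ∀ p ∈ X, p.Prime ∧ p.Coprime m ∧ N / 4 ≤ p ∧ (p : ℝ) ≤ N) (hX0 : 0 < X.card) :
    (m : ℝ) - (coprimeProductClasses m N S Y).ncard ≤
      4 * m * crossTotal m ⌊N⌋₊ (m / (2 * L)) / X.card ^ 2 + X.card * (4 * Y / N + 1) := by
  have hm : 0 < m := Nat.pos_of_ne_zero (NeZero.ne m)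
  have hmR : (0 : ℝ) < m := by exact_mod_cast hm
  have hLR : (0 : ℝ) < L := by exact_mod_cast hL
  have hXR : (0 : ℝ) < X.card := by exact_mod_cast hX0
  set s : ℤ := ⌈S + 1⌉ with hs
  have hs1 : S + 1 ≤ s := Int.le_ceil _
  have hs2 : (s : ℝ) < S + 2 := by linarith [Int.ceil_lt_add_one (S + 1)]
  -- The sums `s + i + j` end at `s + 2L - 2`, which stays below `S + Y` because `s < S + 2` and `2L
  -- ≤ Y`.
  set J : Finset ℤ := Finset.Icc s (s + 2 * L - 2) with hJ
  have hJmem : ∀ y ∈ J, S + 1 ≤ (y : ℝ) ∧ (y : ℝ) ≤ S + Y := by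
    intro y hy
    rw [hJ, Finset.mem_Icc] at hy
    have h1 : (s : ℝ) ≤ y := by exact_mod_cast hy.1
    have h2 : (y : ℝ) ≤ s + 2 * L - 2 := by exact_mod_cast hy.2
    constructor <;> linarith
  classical
  set R : Finset (ZMod m) := (X ×ˢ J).image fun t => ((t.1 : ZMod m) * (t.2 : ZMod m)) with hR
  -- Classes hit by some pair with `p ∣ y`, the only obstruction to coprimality as `p` is prime.
  set B : Finset (ZMod m) := (X.sigma fun p => J.filter fun y => (p : ℤ) ∣ y).image
    fun t => ((t.1 : ZMod m) * (t.2 : ZMod m)) with hB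
  set Z := Finset.univ \ R with hZ
  have hZle : (Z.card : ℝ) ≤ 4 * m * crossTotal m ⌊N⌋₊ (m / (2 * L)) / X.card ^ 2 := by
    rw [le_div_iff₀ (by positivity)]
    have h1 := card_not_product_mul_sq_le hL s X (fun p hp => (hX p hp).2.1) Z ?_
    · have h2 := sum_sq_sum_fejerWeight_le (m := m) (H := m / (2 * L)) (by positivity) ⌊N⌋₊ X
        (fun p hp => (hX p hp).2.1) fun p hp => Finset.mem_Icc.2
          ⟨(hX p hp).1.one_le, Nat.le_floor (hX p hp).2.2.2⟩
      calc _ ≤ _ := h1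
        _ ≤ m * (4 * crossTotal m ⌊N⌋₊ (m / (2 * L))) := by gcongr
        _ = _ := by ring
    · rintro c hc p hp i hi j hj rfl
      rw [hZ, Finset.mem_sdiff] at hc
      refine hc.2 (Finset.mem_image.2 ⟨(p, s + i + j), Finset.mem_product.2 ⟨hp, ?_⟩, ?_⟩)
      · rw [hJ, Finset.mem_Icc]
        simp only
        omega
      · push_cast
        rfl
  have hBle : (B.card : ℝ) ≤ X.card * (4 * Y / N + 1) := by
    have h1 : (B.card : ℝ) ≤ ∑ p ∈ X, ((J.filter fun y => (p : ℤ) ∣ y).card : ℝ) := by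
      have : B.card ≤ (X.sigma fun p => J.filter fun y => (p : ℤ) ∣ y).card :=
        Finset.card_image_le
      rw [Finset.card_sigma] at this
      exact_mod_cast this
    refine h1.trans ?_
    rw [← nsmul_eq_mul]
    refine Finset.sum_le_card_nsmul _ _ _ fun p hp => ?_
    obtain ⟨hpp, -, hpN, -⟩ := hX p hp
    have hp0 : (0 : ℝ) < p := by exact_mod_cast hpp.pos
    have h2 := Int.card_le_of_pairwise_dvd_sub (A := J.filter fun y => (p : ℤ) ∣ y) (u := S)
      (v := S + Y) hpp.pos (by linarith) (fun y hy => ?_) fun y hy z hz =>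
        dvd_sub (Finset.mem_filter.1 hy).2 (Finset.mem_filter.1 hz).2
    · refine h2.trans (add_le_add_left ?_ 1)
      rw [add_sub_cancel_left, div_le_div_iff₀ hp0 hN]
      nlinarith
    · have := hJmem y (Finset.mem_filter.1 hy).1
      constructor <;> linarith
  have hcover : (Finset.univ : Finset (ZMod m)) ⊆
      (Set.toFinite (coprimeProductClasses m N S Y)).toFinset ∪ (Z ∪ B) := by
    intro c _
    rw [Finset.mem_union, Finset.mem_union, Set.Finite.mem_toFinset]
    by_cases hcR : c ∈ R
    · obtain ⟨⟨p, y⟩, hpy, rfl⟩ := Finset.mem_image.1 hcR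
      obtain ⟨hp, hy⟩ := Finset.mem_product.1 hpy
      by_cases hdvd : (p : ℤ) ∣ y
      · exact Or.inr (Or.inr (Finset.mem_image.2 ⟨⟨p, y⟩,
          Finset.mem_sigma.2 ⟨hp, Finset.mem_filter.2 ⟨hy, hdvd⟩⟩, rfl⟩))
      · left
        obtain ⟨hpp, -, hp1, hp2⟩ := hX p hp
        refine ⟨p, y, by exact_mod_cast hp1, by exact_mod_cast hp2, (hJmem y hy).1,
          (hJmem y hy).2, ?_, by push_cast; rfl⟩
        rw [← Int.isCoprime_iff_gcd_eq_one]
        exact (Nat.prime_iff_prime_int.1 hpp).coprime_iff_not_dvd.2 hdvd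
    · exact Or.inr (Or.inl (Finset.mem_sdiff.2 ⟨Finset.mem_univ _, hcR⟩))
  have hcard := (Finset.card_le_card hcover).trans
    ((Finset.card_union_le _ _).trans (Nat.add_le_add_left (Finset.card_union_le _ _) _))
  rw [Finset.card_univ, ZMod.card, ← Set.ncard_eq_toFinset_card] at hcard
  have hcardR : (m : ℝ) ≤ (coprimeProductClasses m N S Y).ncard + (Z.card + B.card) := by
    exact_mod_cast hcard
  linarith

/-- `crossTotal` at the scale `H ≤ 2 m / Y` with `Y = D √m q ℓ`, `q = √(m / φ(m))`, `ℓ = log m`. -/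
theorem log_sq_mul_crossTotal_le {m : ℕ} (hm : 0 < m) {D N H : ℝ} (hD : 1 ≤ D)
    (hl : 1 ≤ Real.log m) (hN : √m ≤ N) (hN2 : √(m : ℝ) * Real.log m ^ 2 ≤ N) (hH0 : 0 < H)
    (hH : H * yLength m D ≤ 2 * m) :
    Real.log m ^ 2 * crossTotal m ⌊N⌋₊ H ≤ 864 / D * N ^ 2 := by
  have hmR : (0 : ℝ) < m := by exact_mod_cast hm
  have hφ : (0 : ℝ) < m.totient := by exact_mod_cast Nat.totient_pos.2 hm
  have hφm : (m.totient : ℝ) ≤ m := by exact_mod_cast Nat.totient_le m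
  set ℓ := Real.log m
  set r := √(m : ℝ)
  have hr0 : 0 < r := Real.sqrt_pos.2 hmR
  have hrr : r ^ 2 = m := Real.sq_sqrt hmR.le
  set q := √((m : ℝ) / m.totient)
  have hq1 : 1 ≤ q := Real.one_le_sqrt.2 ((one_le_div hφ).2 hφm)
  have hqq : q ^ 2 = m / m.totient := Real.sq_sqrt (by positivity)
  have hN0 : 0 < N := hr0.trans_le hN
  have hfl : (⌊N⌋₊ : ℝ) ≤ N := Nat.floor_le hN0.le
  have hD0 : 0 < D := by linarith
  have hHY : H * (D * q * ℓ) ≤ 2 * r := by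
    have : H * (D * q * ℓ) * r ≤ 2 * r * r := by
      rw [yLength] at hH
      calc H * (D * q * ℓ) * r = H * (D * r * q * ℓ) := by ring
        _ ≤ 2 * m := hH
        _ = 2 * r * r := by rw [← hrr]; ring
    exact le_of_mul_le_mul_right this hr0
  have hHℓ : H * (D * ℓ) ≤ 2 * r := by
    refine le_trans ?_ hHY
    gcongr
    nlinarith
  have hDD : 1 / D ^ 2 ≤ 1 / D := one_div_le_one_div_of_le hD0 (by nlinarith)
  -- The factor `q²` in the square of `hHY` absorbs `m/φ(m)` exactly.
  have t1 : ℓ ^ 2 * (4 * N ^ 2 / m * (16 * H ^ 2 * (m / m.totient))) ≤ 256 / D * N ^ 2 := by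
    calc ℓ ^ 2 * (4 * N ^ 2 / m * (16 * H ^ 2 * (m / m.totient)))
        = 64 * N ^ 2 / m * (H * (D * q * ℓ)) ^ 2 / D ^ 2 := by
          rw [← hqq]; field_simp; norm_num
      _ ≤ 64 * N ^ 2 / m * (2 * r) ^ 2 / D ^ 2 := by gcongr
      _ = 256 * N ^ 2 * (1 / D ^ 2) := by rw [mul_pow, hrr]; field_simp; norm_num
      _ ≤ 256 * N ^ 2 * (1 / D) := by gcongr
      _ = _ := by ring
  have t2 : ℓ ^ 2 * (4 * N / m * (8 * H ^ 3 * (1 + ℓ))) ≤ 512 / D * N ^ 2 := by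
    have hD3 : 1 / D ^ 3 ≤ 1 / D := one_div_le_one_div_of_le hD0 (le_self_pow₀ hD (by norm_num))
    calc ℓ ^ 2 * (4 * N / m * (8 * H ^ 3 * (1 + ℓ)))
        ≤ ℓ ^ 2 * (4 * N / m * (8 * H ^ 3 * (2 * ℓ))) := by gcongr; linarith
      _ = 64 * N / m * (H * (D * ℓ)) ^ 3 * (1 / D ^ 3) := by field_simp; norm_num
      _ ≤ 64 * N / m * (2 * r) ^ 3 * (1 / D) := by gcongr
      _ = 512 / D * (N * r) := by rw [← hrr]; field_simp; norm_num
      _ ≤ 512 / D * (N * N) := by gcongr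
      _ = _ := by ring
  -- The only term that needs `N ≥ √m log² m` rather than `N ≥ √m`.
  have t3 : ℓ ^ 2 * (N * (8 * H * (1 + ℓ))) ≤ 32 / D * N ^ 2 := by
    calc ℓ ^ 2 * (N * (8 * H * (1 + ℓ))) ≤ ℓ ^ 2 * (N * (8 * H * (2 * ℓ))) := by
          gcongr; linarith
      _ = 16 * N * ℓ ^ 2 * (H * (D * ℓ)) / D := by field_simp; norm_num
      _ ≤ 16 * N * ℓ ^ 2 * (2 * r) / D := by gcongr
      _ = 32 / D * (N * (r * ℓ ^ 2)) := by ring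
      _ ≤ 32 / D * (N * N) := by gcongr
      _ = _ := by ring
  have t4 : ℓ ^ 2 * (16 * H ^ 2) ≤ 64 / D * N ^ 2 := by
    calc ℓ ^ 2 * (16 * H ^ 2) = 16 * (H * (D * ℓ)) ^ 2 * (1 / D ^ 2) := by field_simp
      _ ≤ 16 * (2 * r) ^ 2 * (1 / D) := by gcongr
      _ = 64 / D * r ^ 2 := by ring
      _ ≤ 64 / D * N ^ 2 := by gcongr
  have hmono : crossTotal m ⌊N⌋₊ H ≤ 4 * N ^ 2 / m * (16 * H ^ 2 * (m / m.totient)) +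
      4 * N / m * (8 * H ^ 3 * (1 + ℓ)) + N * (8 * H * (1 + ℓ)) + 16 * H ^ 2 := by
    rw [crossTotal]
    gcongr
  calc _ ≤ ℓ ^ 2 * (4 * N ^ 2 / m * (16 * H ^ 2 * (m / m.totient)) +
      4 * N / m * (8 * H ^ 3 * (1 + ℓ)) + N * (8 * H * (1 + ℓ)) + 16 * H ^ 2) := by gcongr
    _ = ℓ ^ 2 * (4 * N ^ 2 / m * (16 * H ^ 2 * (m / m.totient))) +
      ℓ ^ 2 * (4 * N / m * (8 * H ^ 3 * (1 + ℓ))) + ℓ ^ 2 * (N * (8 * H * (1 + ℓ))) +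
      ℓ ^ 2 * (16 * H ^ 2) := by ring
    _ ≤ 256 / D * N ^ 2 + 512 / D * N ^ 2 + 32 / D * N ^ 2 + 64 / D * N ^ 2 := by gcongr
    _ = _ := by ring

theorem eventually_sub_ncard_coprimeProductClasses_le {δ : ℝ} (hδ : 0 < δ) :
    ∀ᶠ m : ℕ in atTop, ∀ D N S : ℝ, 1 ≤ D → (m : ℝ) ^ (1 / 2 + δ) ≤ N → N ≤ m →
      (m : ℝ) - (coprimeProductClasses m N S (yLength m D)).ncard ≤
        (221184 * D⁻¹ + 2 * (D / Real.log m * √((m : ℝ) / m.totient))) * m := by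
  have h1 := tendsto_natCast_atTop_atTop (R := ℝ) |>.eventually
    (eventually_log_sq_le_mul_rpow hδ one_pos)
  have h2 := tendsto_natCast_atTop_atTop (R := ℝ) |>.eventually
    (eventually_log_sq_le_mul_rpow (δ := 1 / 2) (c := 1) (by norm_num) one_pos)
  filter_upwards [h1, h2, eventually_exists_primes, eventually_ge_atTop 16]
    with m hm1 hm2 hprimes hm16 D N S hD hNδ hNm
  have hm : 0 < m := by omega
  have : NeZero m := ⟨hm.ne'⟩
  have hm16' : (16 : ℝ) ≤ m := by exact_mod_cast hm16
  have hmR : (0 : ℝ) < m := by linarith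
  have hφ : (0 : ℝ) < m.totient := by exact_mod_cast Nat.totient_pos.2 hm
  have hφm : (m.totient : ℝ) ≤ m := by exact_mod_cast Nat.totient_le m
  have hl : 1 ≤ Real.log m := by
    rw [Real.le_log_iff_exp_le (by linarith)]
    linarith [Real.exp_one_lt_d9]
  rw [← Real.sqrt_eq_rpow, one_mul] at hm2
  rw [one_mul] at hm1
  rw [Real.rpow_add hmR, ← Real.sqrt_eq_rpow] at hNδ
  have hr4 : 4 ≤ √(m : ℝ) := Real.le_sqrt_of_sq_le (by linarith)
  have hrr : √(m : ℝ) * √(m : ℝ) = m := Real.mul_self_sqrt hmR.le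
  have hN2 : √(m : ℝ) * Real.log m ^ 2 ≤ N :=
    le_trans (mul_le_mul_of_nonneg_left hm1 (by positivity)) hNδ
  have hNr : √(m : ℝ) ≤ N := (le_mul_of_one_le_right (by positivity) (one_le_pow₀ hl)).trans hN2
  have hN0 : 0 < N := by linarith
  have hD0 : 0 < D := by linarith
  have hq1 : 1 ≤ √((m : ℝ) / m.totient) := Real.one_le_sqrt.2 ((one_le_div hφ).2 hφm)
  obtain ⟨X, hX, hXlow, hXup⟩ := hprimes N hNr hNm
  have hX0 : (0 : ℝ) < X.card := lt_of_lt_of_le (by positivity) hXlow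
  have hY4 : 4 ≤ yLength m D := by
    rw [yLength]
    calc (4 : ℝ) = 1 * 4 * 1 * 1 := by norm_num
      _ ≤ _ := by gcongr
  set Y := yLength m D with hY
  set L := ⌊Y / 2⌋₊ with hL
  have hL1 : (L : ℝ) ≤ Y / 2 := Nat.floor_le (by linarith)
  -- Rounding is harmless because `Y ≥ 4`; this gives `H = m/(2L) ≤ 2m/Y`.
  have hL2 : Y / 4 ≤ L := by linarith [Nat.lt_floor_add_one (Y / 2)]
  have hLR : (0 : ℝ) < L := by linarith
  have hmain := le_ncard_coprimeProductClasses (m := m) (S := S) hN0 (by exact_mod_cast hLR)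
    (by linarith : 2 * (L : ℝ) ≤ Y) X hX (by exact_mod_cast hX0)
  refine hmain.trans ?_
  have hcross := log_sq_mul_crossTotal_le hm hD hl hNr hN2 (H := m / (2 * L)) (by positivity) (by
    rw [← hY, div_mul_eq_mul_div, div_le_iff₀ (by positivity)]
    nlinarith)
  set T := crossTotal m ⌊N⌋₊ (m / (2 * L))
  set ℓ := Real.log m
  set q := √((m : ℝ) / m.totient)
  have hNX : N ≤ 8 * ℓ * X.card := by
    rw [div_le_iff₀ (by positivity)] at hXlow
    linarith
  -- `221184 = 4 · 864 · 64`, where `64` comes from squaring `N ≤ 8 ℓ X.card`.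
  have p1 : 4 * m * T / X.card ^ 2 ≤ 221184 * D⁻¹ * m := by
    rw [div_le_iff₀ (by positivity)]
    have hT : T ≤ 864 / D * (64 * X.card ^ 2) := by
      refine le_of_mul_le_mul_left ?_ (by positivity : 0 < ℓ ^ 2)
      refine hcross.trans ?_
      calc 864 / D * N ^ 2 ≤ 864 / D * (8 * ℓ * X.card) ^ 2 := by gcongr
        _ = _ := by ring
    calc 4 * m * T ≤ 4 * m * (864 / D * (64 * X.card ^ 2)) := by gcongr
      _ = _ := by ring
  -- With `X.card ≤ N/(4ℓ)` the two parts are `Y/ℓ = D√m q` and `N/(4ℓ)`; each is at most `(D/ℓ) q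
  -- m`.
  have p2 : X.card * (4 * Y / N + 1) ≤ 2 * (D / ℓ * q) * m := by
    have hYe : Y = D * √(m : ℝ) * q * ℓ := hY
    have hrl : √(m : ℝ) ≤ m / ℓ := by
      rw [le_div_iff₀ (by positivity)]
      nlinarith
    have e1 : D * √(m : ℝ) * q ≤ D / ℓ * q * m := by
      calc D * √(m : ℝ) * q ≤ D * (m / ℓ) * q := by gcongr
        _ = _ := by ring
    have e2 : N / (4 * ℓ) ≤ D / ℓ * q * m := by
      rw [div_le_iff₀ (by positivity)]
      have hDq : 1 ≤ D * q := one_le_mul_of_one_le_of_one_le hD hq1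
      calc N ≤ 4 * (1 * m) := by linarith
        _ ≤ 4 * (D * q * m) := by gcongr
        _ = _ := by field_simp
    calc X.card * (4 * Y / N + 1) ≤ N / (4 * ℓ) * (4 * Y / N + 1) := by gcongr
      _ = D * √(m : ℝ) * q + N / (4 * ℓ) := by rw [hYe]; field_simp
      _ ≤ _ := by linarith
  linarith

theorem mainTheorem4 (ε : ℝ) (hε : 0 < ε) (hε1 : ε ≤ 1) :
    ∃ C : ℝ, 0 < C ∧
      ∀ Δ : ℕ → ℝ, Tendsto Δ atTop atTop →
        ∀ m : ℕ, 2 ≤ m → 0 < Δ m →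
          ∀ N : ℝ, (m : ℝ) ^ (1 / (2 - ε)) ≤ N → N ≤ (m : ℝ) →
            ∀ S : ℝ,
              |((coprimeProductClasses m N S (yLength m (Δ m))).ncard : ℝ) - (m : ℝ)| ≤
                (C * (Δ m)⁻¹ +
                  C * (Δ m / Real.log (m : ℝ) *
                    Real.sqrt ((m : ℝ) / (Nat.totient m : ℝ)))) * (m : ℝ) := by
  have hδ : 0 < 1 / (2 - ε) - 1 / 2 := by
    rw [sub_pos]
    exact one_div_lt_one_div_of_lt (by linarith) (by linarith)
  obtain ⟨m₀, hm₀⟩ := eventually_atTop.1 (eventually_sub_ncard_coprimeProductClasses_le hδ)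
  have hlog0 : 0 ≤ Real.log m₀ := Real.log_natCast_nonneg m₀
  -- The summand `log m₀` makes the bound trivial for `m ≤ m₀`: there `Δ m ≥ 1` gives `W ≥ 1/log m`,
  -- so `C W ≥ 1`. For `Δ m < 1` the term `C/Δ m` already exceeds `1`.
  refine ⟨221184 + Real.log m₀, by linarith, fun Δ _ m hm hΔ N hN hNm S => ?_⟩
  set C := 221184 + Real.log m₀ with hC
  have : NeZero m := ⟨by omega⟩
  have hm1 : (1 : ℝ) < m := by exact_mod_cast (by omega : 1 < m)
  have hmR : (0 : ℝ) < m := by linarith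
  have hlog : 0 < Real.log m := Real.log_pos hm1
  have hφ : (0 : ℝ) < m.totient := by exact_mod_cast Nat.totient_pos.2 (by omega)
  have hφm : (m.totient : ℝ) ≤ m := by exact_mod_cast Nat.totient_le m
  have hq1 : 1 ≤ √((m : ℝ) / m.totient) := Real.one_le_sqrt.2 ((one_le_div hφ).2 hφm)
  set A := coprimeProductClasses m N S (yLength m (Δ m))
  have hA : (A.ncard : ℝ) ≤ m := by
    have h := Set.ncard_le_ncard (Set.subset_univ A)
    rw [Set.ncard_univ, Nat.card_zmod] at h
    exact_mod_cast h
  have hA0 : (0 : ℝ) ≤ A.ncard := Nat.cast_nonneg _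
  rw [abs_sub_comm, abs_of_nonneg (by linarith)]
  rcases lt_or_ge (Δ m) 1 with h1 | h1
  · have hinv : 1 ≤ (Δ m)⁻¹ := (one_le_inv₀ hΔ).2 h1.le
    have hpos : 0 ≤ C * (Δ m / Real.log m * √((m : ℝ) / m.totient)) := by positivity
    have : 1 ≤ C * (Δ m)⁻¹ := by nlinarith
    nlinarith
  · set W := Δ m / Real.log m * √((m : ℝ) / m.totient) with hW
    have hinv : 0 < (Δ m)⁻¹ := inv_pos.2 hΔ
    have hW0 : 0 ≤ W := by positivity
    rcases le_total m₀ m with h2 | h2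
    · have h := hm₀ m h2 (Δ m) N S h1 (by rwa [add_sub_cancel]) hNm
      refine h.trans ?_
      gcongr <;> linarith
    · have hWl : 1 / Real.log m ≤ W := by
        rw [hW]
        calc 1 / Real.log m = 1 / Real.log m * 1 := (mul_one _).symm
          _ ≤ _ := by gcongr
      have hll : Real.log m ≤ C := by
        have : Real.log m ≤ Real.log m₀ := Real.log_le_log hmR (by exact_mod_cast h2)
        linarith
      have hCW : 1 ≤ C * W := by
        calc 1 = Real.log m * (1 / Real.log m) := by field_simp
          _ ≤ C * W := by gcongr
      have : 0 ≤ C * (Δ m)⁻¹ := by positivity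
      nlinarith
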